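/- **Theorem 3.1.** Let $(X,Y)$ be a dual pair of real locally convex spaces: there is a separating bilinear form $\langle\cdot,\cdot\rangle$ on $Y\times X$, and the topologies of $X$ and $Y$ are compatible with it, i.e. the continuous linear functionals on $X$ are exactly the maps $\langle y,\cdot\rangle$, $y\in Y$, and those on $Y$ are exactly the maps $\langle\cdot,x\rangle$, $x\in X$ (for instance $X$ a Hausdorff locally convex space and $Y=X^*$ with the weak* topology). Let $T$ be a nonempty set, let $\Phi_t:X\to\mathbb R\cup\{+\infty\}$, $t\in T$, be proper, convex and lower semicontinuous, and put $\Phi:=\sup_{t\in T}\Phi_t$, $\operatorname{dom}\Phi:=\{x:\Phi(x)<+\infty\}$, $[\Phi\le\lambda]:=\{x:\Phi(x)\le\lambda\}$. For $S\subset X$ and $\delta\ge 0$ let $\mathrm N^\delta_S(\bar x):=\{y\in Y:\langle y,x-\bar x\rangle\le\delta\ \ \forall x\in S\}$ and let $S_\infty:=\{v\in X: x+rv\in S\ \ \forall x\in S,\ \forall r>0\}$; for $\varepsilon\ge0$ and $\bar x\in\operatorname{dom} f$ let $\partial_\varepsilon f(\bar x):=\{y\in Y:\langle y,u-\bar x\rangle\le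 f(u)-f(\bar x)+\varepsilon\ \ \forall u\in X\}$. Then for every $\bar x\in\operatorname{dom}\Phi$, every $\delta\ge0$ and every $\lambda\in(-\infty,+\infty]$, $$ \mathrm N^{\delta}_{([\Phi\le\lambda]\cap\operatorname{dom}\Phi)\,\cup\,(\bar x+[\Phi\le\Phi(\bar x)]_\infty)}(\bar x) =\limsup_{\substack{\sum_{i=1}^k\mu_i(\nu-\Phi_{t_i}(\bar x)+\varepsilon_i)\to\delta,\ \ \nu\uparrow\lambda\\ \mu_i>0,\ \varepsilon_i\ge0,\ t_i\in T,\ k\ge1}}\ \sum_{i=1}^k\mu_i\,\partial_{\varepsilon_i}\Phi_{t_i}(\bar x). $$ Here $\nu\in\mathbb R$, and $\nu\uparrow\lambda$ means $\nu\to+\infty$ if $\lambda=+\infty$ and $\nu=\lambda$ if $\lambda<+\infty$. The right-hand side is the Painlevé–Kuratowski upper limit in $Y$: the set of all $y\in Y$ such that for every neighbourhood $W$ of $y$ and every $\eta>0$ there are $k\ge1$, $\mu_i>0$, $\varepsilon_i\ge0$, $t_i\in T$ $(1\le i\le k)$ and $\nu\in\mathbb R$, with $\nu>1/\eta$ if $\lambda=+\infty$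 and $\nu=\lambda$ otherwise, such that $\left|\sum_{i=1}^k\mu_i(\nu-\Phi_{t_i}(\bar x)+\varepsilon_i)-\delta\right|<\eta$ and $W\cap\sum_{i=1}^k\mu_i\,\partial_{\varepsilon_i}\Phi_{t_i}(\bar x)\ne\emptyset$. -/

import Mathlib

open Filter Topology
open scoped Pointwise

namespace SublevelNormal

/-- `B` puts `X` and `Y` in (separating) duality, and the given topologies on `X` and on `Y` are
compatible with that duality: the continuous linear functionals on `X` are exactly the `B · y`,
and those on `Y` are exactly the `B x ·`. -/
structure IsCompatibleDualPair {X Y : Type*}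
    [AddCommGroup X] [Module ℝ X] [TopologicalSpace X]
    [AddCommGroup Y] [Module ℝ Y] [TopologicalSpace Y]
    (B : X →ₗ[ℝ] Y →ₗ[ℝ] ℝ) : Prop where
  separatingLeft : B.SeparatingLeft
  separatingRight : B.SeparatingRight
  continuous_left : ∀ y : Y, Continuous fun x : X => B x y
  continuous_right : ∀ x : X, Continuous fun y : Y => B x y
  exists_right : ∀ f : X →L[ℝ] ℝ, ∃ y : Y, ∀ x : X, f x = B x y
  exists_left : ∀ g : Y →L[ℝ] ℝ, ∃ x : X, ∀ y : Y, g y = B x y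

/-- Effective domain of an extended-real-valued function. -/
def effDom {X : Type*} (f : X → EReal) : Set X := {x | f x < ⊤}

/-- The sublevel set `[f ≤ lam]`. -/
def sublevel {X : Type*} (f : X → EReal) (lam : EReal) : Set X := {x | f x ≤ lam}

/-- The class of proper, convex (the epigraph in `X × ℝ` is convex), lower semicontinuous
functions with values in `ℝ ∪ {+∞}`. -/
structure IsGammaZero {X : Type*} [AddCommGroup X] [Module ℝ X] [TopologicalSpace X]
    (f : X → EReal) : Prop where
  ne_bot : ∀ x, f x ≠ ⊥
  proper : (effDom f).Nonempty
  convex : Convex ℝ {p : X × ℝ | f p.1 ≤ (p.2 : EReal)}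
  lsc : LowerSemicontinuous f

/-- The recession (asymptotic) cone of a set: all directions `v` such that every half-line issuing
from a point of `S` in the direction `v` stays in `S`. -/
def recessionCone {X : Type*} [AddCommGroup X] [Module ℝ X] (S : Set X) : Set X :=
  {v | ∀ x ∈ S, ∀ r : ℝ, 0 < r → x + r • v ∈ S}

/-- The `δ`-normal set to `S` at `xbar`. -/
def normalSet {X Y : Type*} [AddCommGroup X] [Module ℝ X] [AddCommGroup Y] [Module ℝ Y]
    (B : X →ₗ[ℝ] Y →ₗ[ℝ] ℝ) (δ : ℝ) (S : Set X) (xbar : X) : Set Y :=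
  {y | ∀ x ∈ S, B (x - xbar) y ≤ δ}

/-- The `ε`-subdifferential of `f` at `x`: empty if `ε < 0` or `x` is not in the domain; otherwise
all `y` with `⟨y, u - x⟩ ≤ f u - f x + ε` for every `u` (written without a subtraction). -/
def epsSubdiff {X Y : Type*} [AddCommGroup X] [Module ℝ X] [AddCommGroup Y] [Module ℝ Y]
    (B : X →ₗ[ℝ] Y →ₗ[ℝ] ℝ) (ε : ℝ) (f : X → EReal) (x : X) : Set Y :=
  {y | 0 ≤ ε ∧ x ∈ effDom f ∧ ∀ u : X, ((B (u - x) y : ℝ) : EReal) + f x ≤ f u + (ε : EReal)}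

/-- The Painlevé–Kuratowski upper limit of a multifunction `M` along a filter `l`: the points `v`
such that for every neighbourhood `W` of `v` and every `Z ∈ l` some `u ∈ Z` has `M u` meeting `W`.
-/
def upperLimit {U V : Type*} [TopologicalSpace V] (l : Filter U) (M : U → Set V) : Set V :=
  {v | ∀ W ∈ 𝓝 v, ∀ Z ∈ l, ∃ u ∈ Z, (M u ∩ W).Nonempty}

/-- The parameters `k ≥ 1`, `t₁, …, t_k ∈ T`, `μ₁, …, μ_k > 0`, `ε₁, …, ε_k ≥ 0` and `ν ∈ ℝ` over
which the upper limit is taken. -/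
structure Param (T : Type*) where
  k : ℕ
  k_pos : 0 < k
  t : Fin k → T
  μ : Fin k → ℝ
  μ_pos : ∀ i, 0 < μ i
  ε : Fin k → ℝ
  ε_nonneg : ∀ i, 0 ≤ ε i
  ν : ℝ

/-- The number `∑ μ_i (ν - Φ_{t_i}(xbar) + ε_i)`; it is used only where all `Φ_{t_i}(xbar)` are
finite. -/
noncomputable def Param.gap {T X : Type*} (p : Param T) (Φ : T → X → EReal) (xbar : X) : ℝ :=
  ∑ i, p.μ i * (p.ν - (Φ (p.t i) xbar).toReal + p.ε i)

/-- The convergence `ν ↑ lam` of real numbers: `ν → +∞` if `lam = +∞`, while `ν = lam` if `lam`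
is finite. -/
noncomputable def increasingTo (lam : EReal) : Filter ℝ :=
  open Classical in if lam = ⊤ then atTop else pure lam.toReal

/-- The mode of convergence `∑ μ_i (ν - Φ_{t_i}(xbar) + ε_i) → δ`, `ν ↑ lam`. -/
noncomputable def paramFilter {T X : Type*} (Φ : T → X → EReal) (xbar : X) (δ : ℝ) (lam : EReal) :
    Filter (Param T) :=
  comap (fun p => p.gap Φ xbar) (𝓝 δ) ⊓ comap (fun p => p.ν) (increasingTo lam)

end SublevelNormal

/-! For a fixed real level ν, the pairs (element of a weighted sum, gap) form a convex cone in Y ×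
ℝ, `gapGraph`; the theorem describes its closure at height δ. The sums lie in the normal set because
weighted subgradient inequalities bound the pairing by the gap on [Φ ≤ ν], and force it to be
nonpositive along recession directions; both bounds pass to the limit. Conversely, if y is normal
but (y, δ) is outside the closure, Hahn–Banach gives (x, α) in X × ℝ, nonpositive on the cone and
positive at (y, δ). Every affine minorant of Φ_t contributes to the cone, and Φ_t is the supremum of
its affine minorants, so nonpositivity becomes a statement on Φ: for α < 0, xbar + x/(-α) lies in [Φ
≤ ν]; for α = 0, x is a recession direction of [Φ ≤ Φ(xbar)]. Either contradicts normality
(`mem_closure_gapGraph`). -/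

namespace SublevelNormal

/-! ### Affine minorants by separation from the epigraph -/

section AffineMinorant

variable {X Y : Type*} [AddCommGroup X] [Module ℝ X] [TopologicalSpace X]
  [AddCommGroup Y] [Module ℝ Y] {B : X →ₗ[ℝ] Y →ₗ[ℝ] ℝ}

/-- To bound a function without the value `-∞` from below by a real number, it suffices to test
against its real upper bounds. -/
lemma coe_le_of_forall_real {a : EReal} {r : ℝ} (ha : a ≠ ⊥)
    (h : ∀ s : ℝ, a ≤ (s : EReal) → r ≤ s) : (r : EReal) ≤ a := by
  induction a with
  | bot => exact absurd rfl ha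
  | coe s => exact EReal.coe_le_coe_iff.2 (h s le_rfl)
  | top => exact le_top

lemma IsGammaZero.isClosed_epigraph {f : X → EReal} (hf : IsGammaZero f) :
    IsClosed {p : X × ℝ | f p.1 ≤ (p.2 : EReal)} := by
  have h := hf.lsc.isClosed_epigraph
  exact h.preimage (f := fun p : X × ℝ => (p.1, (p.2 : EReal)))
    (continuous_fst.prodMk (continuous_coe_real_ereal.comp continuous_snd))

/-- A non-vertical separating hyperplane yields a continuous affine minorant. -/
lemma IsGammaZero.exists_affine_minorant_of_separation {f : X → EReal} (hf : IsGammaZero f)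
    {x₀ : X} {m : ℝ} {y : Y} {α u : ℝ} (hα : 0 < α) (h₀ : B x₀ y + α * m < u)
    (h : ∀ (x : X) (s : ℝ), f x ≤ (s : EReal) → u < B x y + α * s) :
    ∃ (z : Y) (c : ℝ), (∀ x, ((B x z + c : ℝ) : EReal) ≤ f x) ∧ m < B x₀ z + c := by
  have key : ∀ x, B x (-(α⁻¹ • y)) + α⁻¹ * u = (u - B x y) / α := fun x => by
    rw [map_neg, map_smul, smul_eq_mul]; field_simp; ring
  refine ⟨-(α⁻¹ • y), α⁻¹ * u, fun x => coe_le_of_forall_real (hf.ne_bot x) fun s hs => ?_, ?_⟩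
  · rw [key, div_le_iff₀ hα]
    linarith [h x s hs]
  · rw [key, lt_div_iff₀ hα]
    linarith

variable [TopologicalSpace Y]

/-- A continuous linear functional on `X × ℝ` is given by an element of `Y` and a real number. -/
lemma IsCompatibleDualPair.exists_repr_left (hB : IsCompatibleDualPair B) (L : (X × ℝ) →L[ℝ] ℝ) :
    ∃ (y : Y) (α : ℝ), ∀ x s, L (x, s) = B x y + α * s := by
  obtain ⟨y, hy⟩ := hB.exists_right (L.comp (ContinuousLinearMap.inl ℝ X ℝ))
  refine ⟨y, L (0, 1), fun x s => ?_⟩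
  have h : ((x, s) : X × ℝ) = (x, 0) + s • (0, 1) := by simp
  rw [h, map_add, map_smul, ← hy x]
  simp [mul_comm]

/-- A continuous linear functional on `Y × ℝ` is given by an element of `X` and a real number. -/
lemma IsCompatibleDualPair.exists_repr_right (hB : IsCompatibleDualPair B)
    (L : (Y × ℝ) →L[ℝ] ℝ) :
    ∃ (x : X) (α : ℝ), ∀ y s, L (y, s) = B x y + α * s := by
  obtain ⟨x, hx⟩ := hB.exists_left (L.comp (ContinuousLinearMap.inl ℝ Y ℝ))
  refine ⟨x, L (0, 1), fun y s => ?_⟩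
  have h : ((y, s) : Y × ℝ) = (y, 0) + s • (0, 1) := by simp
  rw [h, map_add, map_smul, ← hx y]
  simp [mul_comm]

variable [IsTopologicalAddGroup X] [ContinuousSMul ℝ X] [LocallyConvexSpace ℝ X]

/-- Separation of a point strictly below the graph from the epigraph. -/
lemma IsGammaZero.exists_separation (hB : IsCompatibleDualPair B) {f : X → EReal}
    (hf : IsGammaZero f) {x₀ : X} {m : ℝ} (hm : (m : EReal) < f x₀) :
    ∃ (y : Y) (α u : ℝ), 0 ≤ α ∧ B x₀ y + α * m < u ∧
      ∀ (x : X) (s : ℝ), f x ≤ (s : EReal) → u < B x y + α * s := by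
  obtain ⟨L, u, h₀, h₁⟩ := geometric_hahn_banach_point_closed (x := ((x₀, m) : X × ℝ))
    hf.convex hf.isClosed_epigraph (not_le.2 hm)
  obtain ⟨y, α, hL⟩ := hB.exists_repr_left L
  have h₂ : ∀ (x : X) (s : ℝ), f x ≤ (s : EReal) → u < B x y + α * s := fun x s hs => by
    rw [← hL]; exact h₁ (x, s) hs
  refine ⟨y, α, u, ?_, by rw [← hL]; exact h₀, h₂⟩
  by_contra! hα
  obtain ⟨x, hx⟩ := hf.proper
  have hx' : f x ≤ ((f x).toReal : EReal) := EReal.le_coe_toReal (ne_of_lt hx)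
  -- The epigraph is unbounded upwards: a height this large violates the separation if α < 0.
  set s := max (f x).toReal ((u - B x y) / α)
  have h₃ := h₂ x s (hx'.trans (EReal.coe_le_coe_iff.2 (le_max_left _ _)))
  have h₄ : α * s ≤ α * ((u - B x y) / α) := mul_le_mul_of_nonpos_left (le_max_right _ _) hα.le
  rw [mul_div_cancel₀ _ hα.ne] at h₄
  linarith

/-- A proper convex lower semicontinuous function is the supremum of its continuous affine
minorants. -/
lemma IsGammaZero.exists_affine_minorant (hB : IsCompatibleDualPair B) {f : X → EReal}
    (hf : IsGammaZero f) {x₀ : X} {m : ℝ} (hm : (m : EReal) < f x₀) :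
    ∃ (y : Y) (c : ℝ), (∀ x, ((B x y + c : ℝ) : EReal) ≤ f x) ∧ m < B x₀ y + c := by
  obtain ⟨y, α, u, hα, h₀, h⟩ := hf.exists_separation hB hm
  rcases hα.lt_or_eq with hα | rfl
  · exact hf.exists_affine_minorant_of_separation hα h₀ h
  -- Vertical hyperplane: `u - B x y` is negative on the domain and positive at `x₀`, so a large
  -- multiple of it is added to some affine minorant, obtained at a domain point, where separation
  -- cannot be vertical.
  obtain ⟨x₁, hx₁⟩ := hf.proper
  have hcoe : ((f x₁).toReal : EReal) = f x₁ := EReal.coe_toReal (ne_of_lt hx₁) (hf.ne_bot x₁)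
  have hm₁ : (((f x₁).toReal - 1 : ℝ) : EReal) < f x₁ := by
    conv_rhs => rw [← hcoe]
    exact EReal.coe_lt_coe_iff.2 (by linarith)
  obtain ⟨y₁, α₁, u₁, hα₁, h₁, h₁'⟩ := hf.exists_separation hB hm₁
  have hα₁' : 0 < α₁ := by
    refine hα₁.lt_of_ne ?_
    rintro rfl
    have := h₁' x₁ _ hcoe.ge
    linarith
  obtain ⟨z, c, hz, -⟩ := hf.exists_affine_minorant_of_separation hα₁' h₁ h₁'
  simp only [zero_mul, add_zero] at h h₀
  have hgap : 0 < u - B x₀ y := by linarith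
  set k := (|m - B x₀ z - c| + 1) / (u - B x₀ y) with hk
  have hk₀ : 0 ≤ k := by positivity
  have key : ∀ x, B x (z - k • y) + (c + k * u) = B x z + c + k * (u - B x y) := fun x => by
    rw [map_sub, map_smul, smul_eq_mul]; ring
  refine ⟨z - k • y, c + k * u, fun x => coe_le_of_forall_real (hf.ne_bot x) fun s hs => ?_, ?_⟩
  · rw [key]
    have h₂ := EReal.coe_le_coe_iff.1 ((hz x).trans hs)
    have h₃ : k * (u - B x y) ≤ 0 :=
      mul_nonpos_of_nonneg_of_nonpos hk₀ (by linarith [h x s hs])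
    linarith
  · rw [key, hk, div_mul_cancel₀ _ hgap.ne']
    linarith [le_abs_self (m - B x₀ z - c)]

end AffineMinorant

/-! ### The cone of weighted sums and gaps -/

section WeightedSums

variable {X Y T : Type*} [AddCommGroup X] [Module ℝ X] [AddCommGroup Y] [Module ℝ Y]
  (B : X →ₗ[ℝ] Y →ₗ[ℝ] ℝ) (Φ : T → X → EReal) (xbar : X)

/-- The weighted sum of `ε`-subdifferentials determined by a parameter. -/
abbrev Param.subdiffSum (p : Param T) : Set Y :=
  ∑ i, p.μ i • epsSubdiff B (p.ε i) (Φ (p.t i)) xbar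

/-- The pairs formed by an element of a weighted sum of subdifferentials with parameter `ν` and
the corresponding gap. -/
def gapGraph (ν : ℝ) : Set (Y × ℝ) :=
  {q | ∃ p : Param T, p.ν = ν ∧ p.gap Φ xbar = q.2 ∧ q.1 ∈ p.subdiffSum B Φ xbar}

/-- Concatenation of two parameters; the level is that of the first one. -/
def Param.append (p q : Param T) : Param T where
  k := p.k + q.k
  k_pos := Nat.add_pos_left p.k_pos _
  t := Fin.append p.t q.t
  μ := Fin.append p.μ q.μ
  μ_pos := Fin.addCases (fun i => by simpa using p.μ_pos i) (fun i => by simpa using q.μ_pos i)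
  ε := Fin.append p.ε q.ε
  ε_nonneg := Fin.addCases (fun i => by simpa using p.ε_nonneg i)
    (fun i => by simpa using q.ε_nonneg i)
  ν := p.ν

/-- Multiplication of all weights by a positive number. -/
def Param.scale (p : Param T) {c : ℝ} (hc : 0 < c) : Param T where
  k := p.k
  k_pos := p.k_pos
  t := p.t
  μ i := c * p.μ i
  μ_pos i := mul_pos hc (p.μ_pos i)
  ε := p.ε
  ε_nonneg := p.ε_nonneg
  ν := p.ν

variable {B Φ xbar}

/-- Concatenating two parameter lists of the same level adds both the sums and the gaps. -/
lemma gapGraph_add_mem {ν : ℝ} {a b : Y × ℝ} (ha : a ∈ gapGraph B Φ xbar ν)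
    (hb : b ∈ gapGraph B Φ xbar ν) : a + b ∈ gapGraph B Φ xbar ν := by
  obtain ⟨p, hp, hpa, hap⟩ := ha
  obtain ⟨q, hq, hqb, hbq⟩ := hb
  refine ⟨p.append q, hp, ?_, ?_⟩
  · rw [Prod.snd_add, ← hpa, ← hqb]
    exact (Fin.sum_univ_add _).trans (by simp [Param.gap, Param.append, hp, hq])
  · have h : (p.append q).subdiffSum B Φ xbar = p.subdiffSum B Φ xbar + q.subdiffSum B Φ xbar :=
      (Fin.sum_univ_add _).trans (by simp [Param.subdiffSum, Param.append])
    rw [h]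
    exact Set.add_mem_add hap hbq

lemma gapGraph_smul_mem {ν c : ℝ} (hc : 0 < c) {a : Y × ℝ} (ha : a ∈ gapGraph B Φ xbar ν) :
    c • a ∈ gapGraph B Φ xbar ν := by
  obtain ⟨p, hp, hpa, hap⟩ := ha
  refine ⟨p.scale hc, hp, ?_, ?_⟩
  · rw [Prod.smul_snd, ← hpa, smul_eq_mul, Param.gap, Param.gap, Finset.mul_sum]
    exact Finset.sum_congr rfl fun i _ => by simp only [Param.scale]; ring
  · have h : (p.scale hc).subdiffSum B Φ xbar = c • p.subdiffSum B Φ xbar := by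
      simp only [Param.subdiffSum, Param.scale, Finset.smul_sum, mul_smul]
      rfl
    rw [h]
    exact Set.smul_mem_smul_set hap

lemma convex_gapGraph (ν : ℝ) : Convex ℝ (gapGraph B Φ xbar ν) :=
  convex_iff_forall_pos.2 fun _ ha _ hb _ _ hs ht _ =>
    gapGraph_add_mem (gapGraph_smul_mem hs ha) (gapGraph_smul_mem ht hb)

/-- Affine minorants give elements of the gap graph. -/
lemma mem_gapGraph_of_minorant {t : T} (hbot : Φ t xbar ≠ ⊥) (htop : Φ t xbar < ⊤) {y : Y} {c : ℝ}
    (h : ∀ u, ((B u y + c : ℝ) : EReal) ≤ Φ t u) (ν : ℝ) {s : ℝ} (hs : ν - c - B xbar y ≤ s) :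
    (y, s) ∈ gapGraph B Φ xbar ν := by
  have hcoe : ((Φ t xbar).toReal : EReal) = Φ t xbar := EReal.coe_toReal htop.ne hbot
  have hx : B xbar y + c ≤ (Φ t xbar).toReal := by
    have := h xbar
    rwa [← hcoe, EReal.coe_le_coe_iff] at this
  -- This ε, with k = 1 and μ = 1, makes the gap exactly `s`.
  have hε : 0 ≤ s - ν + (Φ t xbar).toReal := by linarith
  refine ⟨⟨1, one_pos, fun _ => t, fun _ => 1, fun _ => one_pos,
    fun _ => s - ν + (Φ t xbar).toReal, fun _ => hε, ν⟩, rfl, ?_, ?_⟩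
  · simp [Param.gap]
  · simp only [Param.subdiffSum, Finset.univ_unique, Finset.sum_const, Finset.card_singleton,
      one_smul]
    refine ⟨hε, htop, fun u => ?_⟩
    have h₁ : ((B (u - xbar) y : ℝ) : EReal) + Φ t xbar ≤
        ((B u y + c : ℝ) : EReal) + ((s - ν + (Φ t xbar).toReal : ℝ) : EReal) := by
      conv_lhs => rw [← hcoe]
      norm_cast
      rw [map_sub, LinearMap.sub_apply]
      linarith
    exact h₁.trans (add_le_add_left (h u) _)

/-- An `ε`-subgradient bounds increments of the function. -/
lemma le_sub_add_of_mem_epsSubdiff {f : X → EReal} {ε : ℝ} {y : Y} (hbot : f xbar ≠ ⊥)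
    (hy : y ∈ epsSubdiff B ε f xbar) {u : X} {r : ℝ} (hu : f u ≤ (r : EReal)) :
    B (u - xbar) y ≤ r - (f xbar).toReal + ε := by
  obtain ⟨-, hx, h⟩ := hy
  have h₁ := (h u).trans (add_le_add_left hu _)
  rw [← EReal.coe_toReal (ne_of_lt hx) hbot] at h₁
  norm_cast at h₁
  linarith

lemma Param.mem_subdiffSum {p : Param T} {y : Y} :
    y ∈ p.subdiffSum B Φ xbar ↔
      ∃ g : Fin p.k → Y, (∀ i, g i ∈ epsSubdiff B (p.ε i) (Φ (p.t i)) xbar) ∧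
        ∑ i, p.μ i • g i = y := by
  rw [Param.subdiffSum, Set.mem_fintype_sum]
  constructor
  · rintro ⟨g, hg, rfl⟩
    choose z hz hzg using fun i => Set.mem_smul_set.1 (hg i)
    exact ⟨z, hz, Finset.sum_congr rfl fun i _ => hzg i⟩
  · rintro ⟨g, hg, rfl⟩
    exact ⟨fun i => p.μ i • g i, fun i => Set.smul_mem_smul_set (hg i), rfl⟩

lemma Param.apply_sub_le_gap {p : Param T} (hbot : ∀ t, Φ t xbar ≠ ⊥) {y : Y}
    (hy : y ∈ p.subdiffSum B Φ xbar) {u : X} (hu : ∀ t, Φ t u ≤ (p.ν : EReal)) :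
    B (u - xbar) y ≤ p.gap Φ xbar := by
  obtain ⟨g, hg, rfl⟩ := p.mem_subdiffSum.1 hy
  rw [map_sum, Param.gap]
  refine Finset.sum_le_sum fun i _ => ?_
  rw [map_smul, smul_eq_mul]
  exact mul_le_mul_of_nonneg_left (le_sub_add_of_mem_epsSubdiff (hbot _) (hg i) (hu _))
    (p.μ_pos i).le

/-- A subgradient with positive slope along the ray would make Φ_t unbounded there. -/
lemma Param.apply_nonpos_of_ray_bounded {p : Param T} (hbot : ∀ t, Φ t xbar ≠ ⊥) {y : Y}
    (hy : y ∈ p.subdiffSum B Φ xbar) {v : X} {M : ℝ}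
    (hv : ∀ t, ∀ r : ℝ, 0 < r → Φ t (xbar + r • v) ≤ (M : EReal)) :
    B v y ≤ 0 := by
  obtain ⟨g, hg, rfl⟩ := p.mem_subdiffSum.1 hy
  rw [map_sum]
  refine Finset.sum_nonpos fun i _ => ?_
  rw [map_smul, smul_eq_mul]
  refine mul_nonpos_of_nonneg_of_nonpos (p.μ_pos i).le ?_
  by_contra! hpos
  set C := M - (Φ (p.t i) xbar).toReal + p.ε i
  have h := le_sub_add_of_mem_epsSubdiff (hbot _) (hg i)
    (hv (p.t i) ((|C| + 1) / B v (g i)) (by positivity))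
  rw [add_sub_cancel_left, map_smul, LinearMap.smul_apply, smul_eq_mul,
    div_mul_cancel₀ _ hpos.ne'] at h
  linarith [le_abs_self C]

end WeightedSums

/-! ### The convergence ν ↑ λ -/

section Levels

lemma eventually_le_increasingTo {lam a : EReal} (hlam : lam ≠ ⊥) (ha : a ≤ lam) (ha' : a < ⊤) :
    ∀ᶠ ν : ℝ in increasingTo lam, a ≤ (ν : EReal) := by
  unfold increasingTo
  split_ifs with h
  · filter_upwards [eventually_ge_atTop a.toReal] with ν hν
    exact (EReal.le_coe_toReal ha'.ne).trans (EReal.coe_le_coe_iff.2 hν)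
  · rw [eventually_pure, EReal.coe_toReal h hlam]
    exact ha

lemma exists_mem_le_of_mem_increasingTo {lam : EReal} (hlam : lam ≠ ⊥) {V : Set ℝ}
    (hV : V ∈ increasingTo lam) : ∃ ν ∈ V, (ν : EReal) ≤ lam := by
  unfold increasingTo at hV
  split_ifs at hV with h
  · obtain ⟨ν, hν⟩ := Filter.nonempty_of_mem hV
    exact ⟨ν, hν, h ▸ le_top⟩
  · exact ⟨lam.toReal, hV, (EReal.coe_toReal h hlam).le⟩

end Levels

/-- A functional bounded above on a nonempty set stable under positive multiples is nonpositive
there, and the bound is nonnegative. -/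
lemma nonpos_and_nonneg_of_lt_on_cone {E : Type*} [AddCommGroup E] [Module ℝ E] {C : Set E}
    (hC : ∀ c : ℝ, 0 < c → ∀ a ∈ C, c • a ∈ C) (hne : C.Nonempty) (L : E →ₗ[ℝ] ℝ) {u : ℝ}
    (h : ∀ a ∈ C, L a < u) : (∀ a ∈ C, L a ≤ 0) ∧ 0 ≤ u := by
  have h' : ∀ a ∈ C, ∀ c : ℝ, 0 < c → c * L a < u := fun a ha c hc => by
    simpa using h _ (hC c hc a ha)
  constructor
  · intro a ha
    by_contra! hpos
    have := h' a ha ((|u| + 1) / L a) (by positivity)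
    rw [div_mul_cancel₀ _ hpos.ne'] at this
    linarith [le_abs_self u]
  · obtain ⟨a, ha⟩ := hne
    have hlim : Tendsto (fun c : ℝ => c * L a) (𝓝[>] 0) (𝓝 0) := by
      have : Tendsto (fun c : ℝ => c * L a) (𝓝 0) (𝓝 (0 * L a)) :=
        (continuous_id.mul continuous_const).tendsto 0
      rw [zero_mul] at this
      exact this.mono_left nhdsWithin_le_nhds
    exact le_of_tendsto hlim (eventually_mem_nhdsWithin.mono fun c hc => (h' a ha c hc).le)

/-! ### The two inclusions -/

section Main

variable {X Y T : Type*}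
  [AddCommGroup X] [Module ℝ X] [TopologicalSpace X]
  [AddCommGroup Y] [Module ℝ Y] [TopologicalSpace Y]
  {B : X →ₗ[ℝ] Y →ₗ[ℝ] ℝ} {Φt : T → X → EReal} {Φ : X → EReal} {xbar : X} {δ : ℝ}

lemma upperLimit_subset_normalSet (hB : IsCompatibleDualPair B)
    (hΦt : ∀ t, IsGammaZero (Φt t)) (hΦ : ∀ x, Φ x = ⨆ t, Φt t x) (hxbar : xbar ∈ effDom Φ)
    (hδ : 0 ≤ δ) {lam : EReal} (hlam : lam ≠ ⊥) :
    upperLimit (paramFilter Φt xbar δ lam) (Param.subdiffSum B Φt xbar) ⊆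
      normalSet B δ ((sublevel Φ lam ∩ effDom Φ) ∪
        (xbar +ᵥ recessionCone (sublevel Φ (Φ xbar)))) xbar := by
  have hle : ∀ t x, Φt t x ≤ Φ x := fun t x => by rw [hΦ]; exact le_iSup (fun t => Φt t x) t
  have hbot : ∀ t, Φt t xbar ≠ ⊥ := fun t => (hΦt t).ne_bot xbar
  intro y hy x hx
  by_contra! hlt
  -- The value r separates the gaps, close to δ, from the pairings near y.
  obtain ⟨r, hδr, hr⟩ := exists_between hlt
  have hW : {z : Y | r < B (x - xbar) z} ∈ 𝓝 y :=
    (hB.continuous_right (x - xbar)).continuousAt.eventually (lt_mem_nhds hr)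
  have hgap : {p : Param T | p.gap Φt xbar < r} ∈ paramFilter Φt xbar δ lam :=
    mem_inf_of_left (preimage_mem_comap (Iio_mem_nhds hδr))
  rcases hx with ⟨hxl, hxd⟩ | hx
  · have hν : {p : Param T | Φ x ≤ (p.ν : EReal)} ∈ paramFilter Φt xbar δ lam :=
      mem_inf_of_right (preimage_mem_comap (eventually_le_increasingTo hlam hxl hxd))
    obtain ⟨p, ⟨hp₁, hp₂⟩, z, hz, hzW⟩ := hy _ hW _ (inter_mem hgap hν)
    have := p.apply_sub_le_gap hbot hz fun t => (hle t x).trans hp₂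
    exact absurd (hzW.trans_le this) hp₁.not_gt
  · obtain ⟨v, hv, rfl⟩ := hx
    obtain ⟨p, -, z, hz, hzW⟩ := hy _ hW _ hgap
    simp only [vadd_eq_add, add_sub_cancel_left, Set.mem_ofPred_eq] at hzW
    have := p.apply_nonpos_of_ray_bounded hbot hz (v := v) (M := (Φ xbar).toReal) fun t r hr =>
      (hle t _).trans ((hv xbar (le_refl (Φ xbar)) r hr).trans (EReal.le_coe_toReal (ne_of_lt hxbar)))
    linarith

variable [IsTopologicalAddGroup X] [ContinuousSMul ℝ X] [LocallyConvexSpace ℝ X]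
  [IsTopologicalAddGroup Y] [ContinuousSMul ℝ Y] [LocallyConvexSpace ℝ Y]

/-- The points of the normal set at a real level, paired with `δ`, are limits of the gap graph. -/
lemma mem_closure_gapGraph [Nonempty T] (hB : IsCompatibleDualPair B)
    (hΦt : ∀ t, IsGammaZero (Φt t)) (hΦ : ∀ x, Φ x = ⨆ t, Φt t x) (hxbar : xbar ∈ effDom Φ)
    {ν : ℝ} {y : Y}
    (hlev : ∀ x ∈ sublevel Φ (ν : EReal), B (x - xbar) y ≤ δ)
    (hrec : ∀ v ∈ recessionCone (sublevel Φ (Φ xbar)), B v y ≤ 0) :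
    (y, δ) ∈ closure (gapGraph B Φt xbar ν) := by
  have hle : ∀ t x, Φt t x ≤ Φ x := fun t x => by rw [hΦ]; exact le_iSup (fun t => Φt t x) t
  have hbot : ∀ t, Φt t xbar ≠ ⊥ := fun t => (hΦt t).ne_bot xbar
  have htop : ∀ t, Φt t xbar < ⊤ := fun t => (hle t xbar).trans_lt hxbar
  have hminor : ∀ t x (m : ℝ), (m : EReal) < Φt t x →
      ∃ (z : Y) (c : ℝ), (∀ u, ((B u z + c : ℝ) : EReal) ≤ Φt t u) ∧ m < B x z + c :=
    fun t x m hm => (hΦt t).exists_affine_minorant hB hm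
  obtain ⟨t₀⟩ := ‹Nonempty T›
  obtain ⟨z₀, c₀, hz₀, -⟩ := hminor t₀ xbar ((Φt t₀ xbar).toReal - 1) (by
    conv_rhs => rw [← EReal.coe_toReal (htop t₀).ne (hbot t₀)]
    exact EReal.coe_lt_coe_iff.2 (by linarith))
  by_contra hnot
  obtain ⟨L, u, hLu, huL⟩ :=
    geometric_hahn_banach_closed_point (convex_gapGraph ν).closure isClosed_closure hnot
  obtain ⟨x, α, hL⟩ := hB.exists_repr_right L
  obtain ⟨hL₀, hu⟩ := nonpos_and_nonneg_of_lt_on_cone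
    (fun c hc a ha => gapGraph_smul_mem (B := B) (Φ := Φt) (xbar := xbar) (ν := ν) hc ha)
    ⟨_, mem_gapGraph_of_minorant (hbot t₀) (htop t₀) hz₀ ν le_rfl⟩ (L : (Y × ℝ) →ₗ[ℝ] ℝ)
    (fun a ha => hLu a (subset_closure ha))
  have hneg : ∀ t z c, (∀ u, ((B u z + c : ℝ) : EReal) ≤ Φt t u) →
      ∀ s, ν - c - B xbar z ≤ s → B x z + α * s ≤ 0 := fun t z c hz s hs => by
    rw [← hL]
    exact hL₀ _ (mem_gapGraph_of_minorant (hbot t) (htop t) hz ν hs)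
  have hpos : 0 < B x y + α * δ := by
    rw [← hL]; exact hu.trans_lt huL
  have hα : α ≤ 0 := by
    by_contra! hα
    -- Gaps may be enlarged freely; this one would give 1 ≤ 0.
    have h₁ := hneg t₀ z₀ c₀ hz₀ _ (le_max_left _ ((1 - B x z₀) / α))
    have h₂ := mul_le_mul_of_nonneg_left
      (le_max_right (ν - c₀ - B xbar z₀) ((1 - B x z₀) / α)) hα.le
    rw [mul_div_cancel₀ _ hα.ne'] at h₂
    linarith
  rcases hα.lt_or_eq with hα | rfl
  -- After division by -α, `hneg` says that every affine minorant is at most ν at xbar + w.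
  · set w := (-α)⁻¹ • x with hw
    have hα' : 0 < -α := by linarith
    have hwB : ∀ z, B w z = B x z / (-α) := fun z => by
      rw [hw, map_smul, LinearMap.smul_apply, smul_eq_mul]; field_simp
    have hmem : xbar + w ∈ sublevel Φ (ν : EReal) := by
      change Φ _ ≤ _
      rw [hΦ]
      refine iSup_le fun t => ?_
      by_contra! hlt
      obtain ⟨z, c, hz, hzc⟩ := hminor t _ ν hlt
      have h := hneg t z c hz _ le_rfl
      have h' : B w z ≤ ν - c - B xbar z := by
        rw [hwB, div_le_iff₀ hα']; linarith
      rw [map_add, LinearMap.add_apply] at hzc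
      linarith
    have h := hlev _ hmem
    rw [add_sub_cancel_left, hwB, div_le_iff₀ hα'] at h
    linarith
  -- With α = 0, `hneg` says that no affine minorant increases in the direction x.
  · have hmem : x ∈ recessionCone (sublevel Φ (Φ xbar)) := by
      intro z hz r hr
      change Φ _ ≤ _
      rw [hΦ (z + r • x)]
      refine iSup_le fun t => ?_
      by_contra! hlt
      have hcoe : ((Φ xbar).toReal : EReal) = Φ xbar :=
        EReal.coe_toReal (ne_of_lt hxbar)
          (fun h => hbot t (le_bot_iff.1 ((hle t xbar).trans h.le)))
      rw [← hcoe] at hlt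
      obtain ⟨e, c, he, hec⟩ := hminor t _ _ hlt
      have h₁ := hneg t e c he _ le_rfl
      have h₂ : B z e + c ≤ (Φ xbar).toReal := by
        have h := ((he z).trans (hle t z)).trans hz
        rwa [← hcoe, EReal.coe_le_coe_iff] at h
      rw [map_add, map_smul, LinearMap.add_apply, LinearMap.smul_apply, smul_eq_mul] at hec
      have h₃ : r * B x e ≤ 0 := mul_nonpos_of_nonneg_of_nonpos hr.le (by linarith)
      linarith
    have := hrec x hmem
    linarith

lemma normalSet_subset_upperLimit [Nonempty T] (hB : IsCompatibleDualPair B)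
    (hΦt : ∀ t, IsGammaZero (Φt t)) (hΦ : ∀ x, Φ x = ⨆ t, Φt t x) (hxbar : xbar ∈ effDom Φ)
    {lam : EReal} (hlam : lam ≠ ⊥) :
    normalSet B δ ((sublevel Φ lam ∩ effDom Φ) ∪
        (xbar +ᵥ recessionCone (sublevel Φ (Φ xbar)))) xbar ⊆
      upperLimit (paramFilter Φt xbar δ lam) (Param.subdiffSum B Φt xbar) := by
  intro y hy W hW Z hZ
  obtain ⟨Z₁, ⟨U, hU, hUZ⟩, Z₂, ⟨V, hV, hVZ⟩, rfl⟩ := hZ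
  -- One admissible real level ν ≤ λ suffices, as [Φ ≤ ν] lies in [Φ ≤ λ] ∩ dom Φ.
  obtain ⟨ν, hνV, hν⟩ := exists_mem_le_of_mem_increasingTo hlam hV
  have hlev : ∀ x ∈ sublevel Φ (ν : EReal), B (x - xbar) y ≤ δ := fun x hx =>
    hy x (Or.inl ⟨le_trans hx hν, lt_of_le_of_lt hx (EReal.coe_lt_top ν)⟩)
  have hray : ∀ v ∈ recessionCone (sublevel Φ (Φ xbar)), B v y ≤ δ := fun v hv => by
    simpa using hy (xbar + v) (Or.inr ⟨v, hv, rfl⟩)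
  have hrec : ∀ v ∈ recessionCone (sublevel Φ (Φ xbar)), B v y ≤ 0 := fun v hv => by
    by_contra! hpos
    -- The recession cone is stable under positive scaling, so the bound δ improves to 0.
    have h := hray (((|δ| + 1) / B v y) • v) fun x hx r hr => by
      rw [smul_smul]; exact hv x hx _ (by positivity)
    rw [map_smul, LinearMap.smul_apply, smul_eq_mul, div_mul_cancel₀ _ hpos.ne'] at h
    linarith [le_abs_self δ]
  obtain ⟨⟨z, s⟩, ⟨hzW, hsU⟩, p, hpν, hps, hpz⟩ :=
    mem_closure_iff_nhds.1 (mem_closure_gapGraph hB hΦt hΦ hxbar hlev hrec) _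
      (prod_mem_nhds hW hU)
  exact ⟨p, ⟨hUZ (hps ▸ hsU : p.gap Φt xbar ∈ U), hVZ (hpν ▸ hνV : p.ν ∈ V)⟩, z, hpz, hzW⟩

end Main

end SublevelNormal

theorem theorem3p1 {X Y T : Type*}
    [AddCommGroup X] [Module ℝ X] [TopologicalSpace X] [IsTopologicalAddGroup X]
    [ContinuousSMul ℝ X] [LocallyConvexSpace ℝ X]
    [AddCommGroup Y] [Module ℝ Y] [TopologicalSpace Y] [IsTopologicalAddGroup Y]
    [ContinuousSMul ℝ Y] [LocallyConvexSpace ℝ Y]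
    (B : X →ₗ[ℝ] Y →ₗ[ℝ] ℝ) (hB : SublevelNormal.IsCompatibleDualPair B)
    [Nonempty T] (Φt : T → X → EReal) (hΦt : ∀ t, SublevelNormal.IsGammaZero (Φt t))
    (Φ : X → EReal) (hΦ : ∀ x, Φ x = ⨆ t, Φt t x)
    (xbar : X) (hxbar : xbar ∈ SublevelNormal.effDom Φ)
    (δ : ℝ) (hδ : 0 ≤ δ) (lam : EReal) (hlam : lam ≠ ⊥) :
    SublevelNormal.normalSet B δ
        ((SublevelNormal.sublevel Φ lam ∩ SublevelNormal.effDom Φ) ∪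
          (xbar +ᵥ SublevelNormal.recessionCone (SublevelNormal.sublevel Φ (Φ xbar)))) xbar =
      SublevelNormal.upperLimit (SublevelNormal.paramFilter Φt xbar δ lam)
        (fun p => ∑ i, p.μ i • SublevelNormal.epsSubdiff B (p.ε i) (Φt (p.t i)) xbar) :=
  (SublevelNormal.normalSet_subset_upperLimit hB hΦt hΦ hxbar hlam).antisymm
    (SublevelNormal.upperLimit_subset_normalSet hB hΦt hΦ hxbar hδ hlam)
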